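/- Let $R$ be a commutative local ring, let $\mathcal{A}$ be an $R$-Hopf algebra that is finitely generated and projective as an $R$-module, with counit $\varepsilon$, and let $S$ be a commutative $R$-algebra that is finitely generated and projective as an $R$-module and is a left $\mathcal{A}$-module algebra. Assume that $S$ is faithful as an $\mathcal{A}$-module, that $\mathrm{rank}_R(S)=\mathrm{rank}_R(\mathcal{A})$, and that $S^{\mathcal{A}}=R$, i.e. that $R\to S$ is injective with image $S^{\mathcal{A}}$. Here, for a left $\mathcal{A}$-module $V$, $V^{\mathcal{A}}=\{v\in V : av=\varepsilon(a)v \text{ for all } a\in\mathcal{A}\}$; $I=\{\lambda\in\mathcal{A} : a\lambda=\varepsilon(a)\lambda \text{ for all } a\in\mathcal{A}\}$ is the module of left integrals; $IV$ is the $R$-submodule of $V$ generated by all $\lambda v$ with $\lambda\in I$, $v\in V$; and the Hopfological homology of $V$ is $V^{\mathcal{A}}/IV$. The extension $S/R$ is called a tame $\mathcal{A}$-extension if $S^{\mathcal{A}}=R$, $\mathrm{rank}_R(S)=\mathrm{rank}_R(\mathcal{A})$, $S$ is a faithful $\mathcal{A}$-module and $IS=R$. A right $\mathcal{A}^*$-comodule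 $M$, with coaction $m\mapsto\sum m_{(0)}\otimes m_{(1)}$ and $\mathcal{A}^*=\mathrm{Hom}_R(\mathcal{A},R)$, is regarded as a left $\mathcal{A}$-module by $am=\sum m_{(1)}(a)\,m_{(0)}$; then $M^{\mathcal{A}}$ is the module $M^{co\mathcal{A}^*}$ of coinvariants. A relative $(S,\mathcal{A}^*)$-Hopf module is an $S$-module $M$ with a right $\mathcal{A}^*$-comodule structure $\rho$ such that $\rho(ms)=\rho(m)\rho(s)$ (right version) or $\rho(sm)=\rho(s)\rho(m)$ (left version) for all $s\in S$, $m\in M$, where $\rho(s)\in S\otimes_R\mathcal{A}^*$ is the coaction induced by the $\mathcal{A}$-module structure of $S$. (i) If $R$ is a principal ideal domain, then $S/R$ is a tame $\mathcal{A}$-extension if and only if the Hopfological homology $S^{\mathcal{A}}/IS$ of $S$ is zero. (ii) Suppose that $R$ is a field. If $S/R$ is a tame $\mathcal{A}$-extension, then the Hopfological homology of every relative $(S,\mathcal{A}^*)$-Hopf module, right or left, is zero. Moreover, if $\mathcal{A}$ is a local ring and cocommutative, then $S/R$ is Hopf-Galois with $\mathcal{A}$, i.e. the map $j:S\otimes_R\mathcal{A}\to\mathrm{End}_R(S)$,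 $j(s\otimes a)(t)=s\,(at)$, is bijective, if and only if the Hopfological homology of $S$ is zero. -/

import Mathlib

open scoped TensorProduct

noncomputable section

namespace HopfTame

section Action

variable {R A V : Type*} [CommRing R] [Ring A] [HopfAlgebra R A] [AddCommGroup V] [Module R V]

/-- The invariants `V^A = {v | a v = ε(a) v for all a}` of a left `A`-module `V`, the module
structure being given by the algebra map `ρ : A → End_R(V)`. -/
def invariants (ρ : A →ₐ[R] Module.End R V) : Submodule R V where
  carrier := {v | ∀ a : A, ρ a v = Coalgebra.counit (R := R) a • v}
  add_mem' {v w} hv hw a := by rw [map_add, hv a, hw a, smul_add]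
  zero_mem' a := by rw [map_zero, smul_zero]
  smul_mem' r v hv a := by rw [map_smul, hv a, smul_comm]

variable (R A) in
/-- The module `I = A^A` of left integrals of `A`: all `l` with `a l = ε(a) l` for all `a`. -/
def leftIntegrals : Submodule R A := invariants (Algebra.lmul R A)

/-- The `R`-submodule `I V` of `V` generated by all `l v` with `l` a left integral. -/
def integralImage (ρ : A →ₐ[R] Module.End R V) : Submodule R V :=
  Submodule.span R {w | ∃ l ∈ leftIntegrals R A, ∃ v : V, w = ρ l v}

theorem integralImage_le_invariants (ρ : A →ₐ[R] Module.End R V) :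
    integralImage ρ ≤ invariants ρ := by
  refine Submodule.span_le.2 ?_
  rintro _ ⟨l, hl, v, rfl⟩ a
  have h : a * l = Coalgebra.counit (R := R) a • l := hl a
  rw [← Module.End.mul_apply, ← map_mul, h, map_smul, LinearMap.smul_apply]

/-- The Hopfological homology `V^A / I V` of a left `A`-module `V`. -/
abbrev HopfologicalHomology (ρ : A →ₐ[R] Module.End R V) : Type _ :=
  invariants ρ ⧸ (integralImage ρ).submoduleOf (invariants ρ)

end Action

section Extension

variable (R A S : Type*) [CommRing R] [Ring A] [HopfAlgebra R A] [CommRing S] [Algebra R S]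
  [Module A S] [IsScalarTower R A S]

/-- The left `A`-module `S` as an algebra map `A → End_R(S)`. -/
abbrev action : A →ₐ[R] Module.End R S := Algebra.lsmul R R S

variable {S} in
/-- The orbit map `a ↦ a s`. -/
def orbit (s : S) : A →ₗ[R] S := (action R A S).toLinearMap.flip s

/-- `S` is a left `A`-module algebra: `a (s t) = ∑ (a₁ s) (a₂ t)` and `a 1 = ε(a) 1`. -/
structure IsModuleAlgebra : Prop where
  smul_mul : ∀ (a : A) (s t : S), a • (s * t) =
    LinearMap.mul' R S (TensorProduct.map (orbit R A s) (orbit R A t) (Coalgebra.comul (R := R) a))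
  smul_one : ∀ a : A, a • (1 : S) = algebraMap R S (Coalgebra.counit a)

/-- `S^A = R`: the structure map `R → S` is injective, with image the invariants of `S`. -/
def IsHopfExtension : Prop :=
  Function.Injective (algebraMap R S) ∧
    invariants (action R A S) = LinearMap.range (Algebra.linearMap R S)

/-- `S/R` is a tame `A`-extension: `S^A = R`, the ranks agree, `S` is a faithful `A`-module and
`I S = R`. -/
structure IsTame : Prop where
  isHopfExtension : IsHopfExtension R A S
  finrank_eq : Module.finrank R S = Module.finrank R A
  faithful : ∀ a : A, (∀ s : S, a • s = 0) → a = 0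
  integralImage_eq : integralImage (action R A S) = LinearMap.range (Algebra.linearMap R S)

/-- The map `j : S ⊗ A → End_R(S)`, `j (s ⊗ a) (t) = s (a t)`. -/
def galoisMap : S ⊗[R] A →ₗ[R] Module.End R S :=
  TensorProduct.lift ((LinearMap.mul R (Module.End R S)).compl₁₂
    (Algebra.lmul R S).toLinearMap (action R A S).toLinearMap)

theorem galoisMap_tmul (s : S) (a : A) (t : S) : galoisMap R A S (s ⊗ₜ a) t = s * a • t := rfl

/-- `S/R` is Hopf-Galois with `A`: the map `j` is an isomorphism. -/
def IsHopfGalois : Prop := Function.Bijective (galoisMap R A S)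

end Extension

section Comodule

variable (R A : Type*) [CommRing R] [Ring A] [HopfAlgebra R A]

/-- The multiplication of `A^*`: `(f g)(a) = ∑ f(a₁) g(a₂)`. -/
def dualMul : Module.Dual R A →ₗ[R] Module.Dual R A →ₗ[R] Module.Dual R A :=
  TensorProduct.curry
    ((LinearMap.lcomp R R (Coalgebra.comul (R := R) (A := A))) ∘ₗ TensorProduct.dualDistrib R A A)

variable {A} in
/-- Evaluation `m ⊗ f ↦ f(a) m`. -/
def evalAt (M : Type*) [AddCommGroup M] [Module R M] (a : A) : M ⊗[R] Module.Dual R A →ₗ[R] M :=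
  (TensorProduct.rid R M).toLinearMap ∘ₗ (Module.Dual.eval R A a).lTensor M

theorem evalAt_tmul {M : Type*} [AddCommGroup M] [Module R M] (a : A) (m : M)
    (f : Module.Dual R A) : evalAt R M a (m ⊗ₜ f) = f a • m := by
  simp [evalAt]

theorem dualMul_apply (f g : Module.Dual R A) (a : A) : dualMul R A f g a =
    LinearMap.mul' R R (TensorProduct.map f g (Coalgebra.comul (R := R) a)) := by
  change TensorProduct.dualDistrib R A A (f ⊗ₜ g) (Coalgebra.comul (R := R) a) = _
  generalize Coalgebra.comul (R := R) a = x
  induction x with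
  | zero => simp
  | tmul a b => simp
  | add x y hx hy => simp only [map_add, hx, hy]

variable [Module.Finite R A] [Module.Projective R A]

/-- The comultiplication of `A^*`: `Δ f = ∑ f₁ ⊗ f₂` with `f(a b) = ∑ f₁(a) f₂(b)`. -/
def dualComul : Module.Dual R A →ₗ[R] Module.Dual R A ⊗[R] Module.Dual R A where
  toFun f := (dualTensorHomEquiv R A (Module.Dual R A)).symm ((LinearMap.mul R A).compr₂ f)
  map_add' f g := by rw [← map_add]; rfl
  map_smul' r f := by rw [RingHom.id_apply, ← map_smul]; rfl

variable {A} in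
/-- Evaluation `f ⊗ g ↦ f(a) g(b)`. -/
def evalPair (a b : A) : Module.Dual R A ⊗[R] Module.Dual R A →ₗ[R] R :=
  TensorProduct.lift (((LinearMap.mul R R).compl₁₂ (Module.Dual.eval R A a))
    (Module.Dual.eval R A b))

theorem evalPair_dualComul (a b : A) (f : Module.Dual R A) :
    evalPair R a b (dualComul R A f) = f (a * b) := by
  have h : ∀ x, evalPair R a b x = dualTensorHomEquiv R A (Module.Dual R A) x a b := by
    intro x
    induction x with
    | zero => simp
    | tmul f g => simp [evalPair]
    | add x y hx hy => rw [map_add, hx, hy, map_add, LinearMap.add_apply, LinearMap.add_apply]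
  rw [h]
  change dualTensorHomEquiv R A (Module.Dual R A) ((dualTensorHomEquiv R A (Module.Dual R A)).symm
    ((LinearMap.mul R A).compr₂ f)) a b = _
  rw [LinearEquiv.apply_symm_apply]
  rfl

/-- A right `A^*`-comodule structure on an `R`-module `M`. The counit of `A^*` is `f ↦ f 1`. -/
structure DualComodule (M : Type*) [AddCommGroup M] [Module R M] where
  coact : M →ₗ[R] M ⊗[R] Module.Dual R A
  coassoc : ∀ m : M, TensorProduct.assoc R M (Module.Dual R A) (Module.Dual R A)
    (coact.rTensor (Module.Dual R A) (coact m)) = (dualComul R A).lTensor M (coact m)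
  counit : ∀ m : M, TensorProduct.rid R M
    ((Module.Dual.eval R A 1).lTensor M (coact m)) = m

section

variable {R A} {M : Type*} [AddCommGroup M] [Module R M]

/-- The left `A`-module associated with a right `A^*`-comodule: `a m = ∑ m₁(a) m₀`. -/
def DualComodule.toAction (C : DualComodule R A M) : A →ₐ[R] Module.End R M :=
  AlgHom.ofLinearMap
    { toFun := fun a => evalAt R M a ∘ₗ C.coact
      map_add' := fun a b => by
        ext m
        have : ∀ x, evalAt R M (a + b) x = evalAt R M a x + evalAt R M b x := by
          intro x
          induction x with
          | zero => simp
          | tmul m f => simp only [evalAt_tmul, map_add, add_smul]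
          | add x y hx hy => simp only [map_add, hx, hy]; abel
        exact this _
      map_smul' := fun r a => by
        ext m
        have : ∀ x, evalAt R M (r • a) x = r • evalAt R M a x := by
          intro x
          induction x with
          | zero => simp
          | tmul m f => simp only [evalAt_tmul, map_smul, smul_assoc]
          | add x y hx hy => simp only [map_add, hx, hy, smul_add]
        exact this _ }
    (by ext m; exact C.counit m)
    (fun a b => by
      ext m
      let E : M ⊗[R] (Module.Dual R A ⊗[R] Module.Dual R A) →ₗ[R] M :=
        (TensorProduct.rid R M).toLinearMap ∘ₗ (evalPair R a b).lTensor M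
      have h1 : ∀ x, evalAt R M (a * b) x = E ((dualComul R A).lTensor M x) := by
        intro x
        induction x with
        | zero => simp
        | tmul m f => simp [evalAt_tmul, E, evalPair_dualComul]
        | add x y hx hy => simp only [map_add, hx, hy]
      have h2 : ∀ (z : M ⊗[R] Module.Dual R A) (g : Module.Dual R A),
          E (TensorProduct.assoc R M _ _ (z ⊗ₜ g)) = g b • evalAt R M a z := by
        intro z g
        induction z with
        | zero => simp
        | tmul m f => simp [evalAt_tmul, E, evalPair, mul_smul, smul_comm (f a)]
        | add x y hx hy => simp only [TensorProduct.add_tmul, map_add, hx, hy, smul_add]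
      have h3 : ∀ x, E (TensorProduct.assoc R M _ _ (C.coact.rTensor _ x)) =
          evalAt R M a (C.coact (evalAt R M b x)) := by
        intro x
        induction x with
        | zero => simp
        | tmul m f => simp [evalAt_tmul, h2]
        | add x y hx hy => simp only [map_add, hx, hy]
      change evalAt R M (a * b) (C.coact m) = evalAt R M a (C.coact (evalAt R M b (C.coact m)))
      rw [h1, ← C.coassoc, h3])

theorem DualComodule.toAction_apply (C : DualComodule R A M) (a : A) (m : M) :
    C.toAction a m = evalAt R M a (C.coact m) := rfl

theorem evalAt_ext {x y : M ⊗[R] Module.Dual R A} (h : ∀ a, evalAt R M a x = evalAt R M a y) :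
    x = y := by
  have key : ∀ (x : M ⊗[R] Module.Dual R A) (a : A),
      dualTensorHomEquiv R A M (TensorProduct.comm R _ _ x) a = evalAt R M a x := by
    intro x a
    induction x with
    | zero => simp
    | tmul m f => simp [evalAt_tmul]
    | add x y hx hy => simp only [map_add, LinearMap.add_apply, hx, hy]
  apply (TensorProduct.comm R _ _).injective
  apply (dualTensorHomEquiv R A M).injective
  ext a
  rw [key, key, h]

/-- The invariants of the associated `A`-module are the coinvariants `{m | coact m = m ⊗ 1}` of
the comodule (the unit of `A^*` is the counit of `A`), so that its Hopfological homology is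
`M^{co A^*} / I M`. -/
theorem DualComodule.mem_invariants_iff (C : DualComodule R A M) (m : M) :
    m ∈ invariants C.toAction ↔ C.coact m = m ⊗ₜ (Coalgebra.counit : A →ₗ[R] R) := by
  constructor
  · intro h
    refine evalAt_ext fun a => ?_
    rw [evalAt_tmul]
    exact h a
  · intro h a
    rw [C.toAction_apply, h, evalAt_tmul]

end

section RelativeHopfModule

variable (S : Type*) [CommRing S] [Algebra R S] [Module A S] [IsScalarTower R A S]

/-- The coaction `S → S ⊗ A^*` induced by the `A`-module structure of `S`: the element of
`S ⊗ A^*` corresponding to the map `a ↦ a s`. -/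
def inducedCoaction : S →ₗ[R] S ⊗[R] Module.Dual R A :=
  (TensorProduct.comm R (Module.Dual R A) S).toLinearMap ∘ₗ
    (dualTensorHomEquiv R A S).symm.toLinearMap ∘ₗ (action R A S).toLinearMap.flip

theorem evalAt_inducedCoaction (a : A) (s : S) :
    evalAt R S a (inducedCoaction R A S s) = a • s := by
  have key : ∀ x : Module.Dual R A ⊗[R] S,
      evalAt R S a (TensorProduct.comm R _ _ x) = dualTensorHomEquiv R A S x a := by
    intro x
    induction x with
    | zero => simp
    | tmul f m => simp [evalAt_tmul]
    | add x y hx hy => simp only [map_add, LinearMap.add_apply, hx, hy]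
  change evalAt R S a (TensorProduct.comm R _ _ ((dualTensorHomEquiv R A S).symm _)) = _
  rw [key, LinearEquiv.apply_symm_apply]
  rfl

variable {R A S} {M : Type*} [AddCommGroup M] [Module R M] [Module S M] [IsScalarTower R S M]

/-- A right relative `(S, A^*)`-Hopf module: an `S`-module and right `A^*`-comodule with
`coact (m s) = coact m * coact s`, that is `∑ m₀ s₀ ⊗ m₁ s₁`. -/
def DualComodule.IsRightHopfModule (C : DualComodule R A M)
    (S : Type*) [CommRing S] [Algebra R S] [Module A S] [IsScalarTower R A S]
    [Module S M] [IsScalarTower R S M] : Prop :=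
  ∀ (m : M) (s : S), C.coact (s • m) =
    TensorProduct.map₂ (Algebra.lsmul R R M : S →ₐ[R] _).toLinearMap.flip (dualMul R A)
      (C.coact m) (inducedCoaction R A S s)

/-- A left relative `(S, A^*)`-Hopf module: an `S`-module and right `A^*`-comodule with
`coact (s m) = coact s * coact m`, that is `∑ s₀ m₀ ⊗ s₁ m₁`. -/
def DualComodule.IsLeftHopfModule (C : DualComodule R A M)
    (S : Type*) [CommRing S] [Algebra R S] [Module A S] [IsScalarTower R A S]
    [Module S M] [IsScalarTower R S M] : Prop :=
  ∀ (s : S) (m : M), C.coact (s • m) =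
    TensorProduct.map₂ (Algebra.lsmul R R M : S →ₐ[R] _).toLinearMap (dualMul R A)
      (inducedCoaction R A S s) (C.coact m)

end RelativeHopfModule

end Comodule

end HopfTame

end

/-! Since `I V ≤ V^A` always holds, homology vanishes exactly when every invariant lies in `I V`.
For `S` with `S^A = R` this says `I S = R`, which is (i). For an invariant `m` of a relative Hopf
module, `s ↦ s m` is `A`-linear, so it carries `1 ∈ I S` to `m ∈ I M`. Hopf-Galois implies zero
homology: `j` surjective, the antipode and a dimension count give `End(S) = ⊕ A e_i` as a left
`A`-module. A projection `S → k ⊆ S` is an invariant there, so its coefficients are integrals, and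
its value at `1` puts `1` in `I S` (`IsHopfGalois.one_mem_integralImage`). Bijectivity of `j` rests
on `A` being local: a nonzero finite-dimensional `A`-module then has a nonzero invariant, so
injectivity can be tested on invariants, where `S^A = k` reduces it to linear independence over `k`
(`sumMulOrbit_injective`). -/

noncomputable section

namespace HopfTame

/-! ### Vanishing homology, tameness and the antipode identity -/

section ModuleAlgebra

variable {R A S : Type*} [CommRing R] [Ring A] [HopfAlgebra R A] [CommRing S] [Algebra R S]
  [Module A S] [IsScalarTower R A S]

theorem subsingleton_hopfologicalHomology_iff {V : Type*} [AddCommGroup V] [Module R V]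
    (ρ : A →ₐ[R] Module.End R V) :
    Subsingleton (HopfologicalHomology ρ) ↔ invariants ρ ≤ integralImage ρ := by
  rw [Submodule.Quotient.subsingleton_iff, Submodule.submoduleOf, Submodule.comap_subtype_eq_top]

theorem isTame_iff (hfaithful : ∀ a : A, (∀ s : S, a • s = 0) → a = 0)
    (hrank : Module.finrank R S = Module.finrank R A) (hext : IsHopfExtension R A S) :
    IsTame R A S ↔ Subsingleton (HopfologicalHomology (action R A S)) := by
  rw [subsingleton_hopfologicalHomology_iff]
  constructor
  · intro h
    rw [h.integralImage_eq, hext.2]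
  · intro h
    exact ⟨hext, hrank, hfaithful, hext.2 ▸ le_antisymm (integralImage_le_invariants _) h⟩

/-- In a module algebra, `(a s) t = ∑ a₁ (s (S(a₂) t))`. -/
theorem IsModuleAlgebra.smul_mul_eq (hmod : IsModuleAlgebra R A S) (a : A) (s t : S) :
    a • s * t = TensorProduct.lift (((action R A S).toLinearMap).compl₂
      ((LinearMap.mulLeft R s) ∘ₗ orbit R A t ∘ₗ HopfAlgebra.antipode R))
      (Coalgebra.comul (R := R) a) := by
  let G : A ⊗[R] (A ⊗[R] A) →ₗ[R] S := LinearMap.mul' R S ∘ₗ TensorProduct.map (orbit R A s)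
    (orbit R A t ∘ₗ LinearMap.mul' R A ∘ₗ (HopfAlgebra.antipode R).lTensor A)
  -- `G` is `b ⊗ c ⊗ d ↦ (b s) (c S(d) t)`; the module algebra law splits the outer action, and
  -- coassociativity then brings `c` and `d` together for the antipode axiom.
  have h1 : ∀ x : A ⊗[R] A, TensorProduct.lift (((action R A S).toLinearMap).compl₂
      ((LinearMap.mulLeft R s) ∘ₗ orbit R A t ∘ₗ HopfAlgebra.antipode R)) x =
      G (TensorProduct.assoc R A A A (Coalgebra.comul.rTensor A x)) := by
    intro x
    induction x with
    | zero => simp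
    | add x y hx hy => simp only [map_add, hx, hy]
    | tmul b c =>
      have h2 : ∀ y : A ⊗[R] A, LinearMap.mul' R S (TensorProduct.map (orbit R A s)
          (orbit R A (HopfAlgebra.antipode R c • t)) y) =
          G (TensorProduct.assoc R A A A (y ⊗ₜ c)) := by
        intro y
        induction y with
        | zero => simp
        | add x y hx hy => simp only [TensorProduct.add_tmul, map_add, hx, hy]
        | tmul d e => simp [G, orbit]
      rw [LinearMap.rTensor_tmul, ← h2, ← hmod.smul_mul]
      simp [orbit]
  have h3 : ∀ x : A ⊗[R] A, G (Coalgebra.comul.lTensor A x) =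
      orbit R A s (TensorProduct.rid R A (Coalgebra.counit.lTensor A x)) * t := by
    intro x
    induction x with
    | zero => simp
    | add x y hx hy => simp only [map_add, hx, hy, add_mul]
    | tmul b c =>
      have := HopfAlgebra.mul_antipode_lTensor_comul_apply (R := R) c
      simp [G, orbit, this]
  rw [h1, Coalgebra.coassoc_apply, h3, Coalgebra.lTensor_counit_comul]
  simp [orbit]

end ModuleAlgebra

/-! ### Relative Hopf modules over a tame extension -/

section RelativeHopfModule

variable {R A S M : Type*} [CommRing R] [Ring A] [HopfAlgebra R A] [Module.Finite R A]
  [Module.Projective R A] [CommRing S] [Algebra R S] [Module A S] [IsScalarTower R A S]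
  [AddCommGroup M] [Module R M] [Module S M] [IsScalarTower R S M] {C : DualComodule R A M}

/-- On a relative Hopf module, `a (s m) = (a s) m` for every invariant `m`. -/
theorem DualComodule.toAction_smul_of_mem_invariants
    (hC : C.IsRightHopfModule S ∨ C.IsLeftHopfModule S) (a : A) (s : S) {m : M}
    (hm : m ∈ invariants C.toAction) : C.toAction a (s • m) = (a • s) • m := by
  rw [C.mem_invariants_iff] at hm
  -- As `ε` is a two-sided unit of `A^*`, the left and right compatibilities give the same formula
  -- `∑ s₀ m ⊗ s₁` on an invariant `m`.
  have hl : ∀ f : Module.Dual R A, dualMul R A Coalgebra.counit f = f := by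
    intro f
    ext a
    rw [dualMul_apply, ← LinearMap.lTensor_comp_rTensor, LinearMap.comp_apply,
      Coalgebra.rTensor_counit_comul]
    simp
  have hr : ∀ f : Module.Dual R A, dualMul R A f Coalgebra.counit = f := by
    intro f
    ext a
    rw [dualMul_apply, ← LinearMap.rTensor_comp_lTensor, LinearMap.comp_apply,
      Coalgebra.lTensor_counit_comul]
    simp
  have key : C.coact (s • m) =
      ((LinearMap.toSpanSingleton S M m).restrictScalars R).rTensor (Module.Dual R A)
        (inducedCoaction R A S s) := by
    rcases hC with hC | hC
    · rw [hC, hm]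
      induction inducedCoaction R A S s with
      | zero => simp
      | add x y hx hy => simp only [map_add, hx, hy]
      | tmul t f => simp [hl]
    · rw [hC, hm]
      induction inducedCoaction R A S s with
      | zero => simp
      | add x y hx hy => simp only [map_add, LinearMap.add_apply, hx, hy]
      | tmul t f => simp [hr]
  rw [C.toAction_apply, key, ← evalAt_inducedCoaction R A S a s]
  induction inducedCoaction R A S s with
  | zero => simp
  | add x y hx hy => simp only [map_add, hx, hy, add_smul]
  | tmul t f => simp [evalAt_tmul]

theorem IsTame.subsingleton_hopfologicalHomology (h : IsTame R A S)
    (hC : C.IsRightHopfModule S ∨ C.IsLeftHopfModule S) :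
    Subsingleton (HopfologicalHomology C.toAction) := by
  rw [subsingleton_hopfologicalHomology_iff]
  intro m hm
  have h1 : (1 : S) ∈ integralImage (action R A S) := by
    rw [h.integralImage_eq]
    exact ⟨1, by simp⟩
  have h2 : integralImage (action R A S) ≤ (integralImage C.toAction).comap
      ((LinearMap.toSpanSingleton S M m).restrictScalars R) := by
    refine Submodule.span_le.2 ?_
    rintro _ ⟨l, hl, s, rfl⟩
    refine Submodule.subset_span ⟨l, hl, s • m, ?_⟩
    rw [DualComodule.toAction_smul_of_mem_invariants hC l s hm]
    simp
  simpa using h2 h1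

end RelativeHopfModule

/-! ### Invariants of modules over a local Hopf algebra -/

section LocalRing

variable {k A : Type*} [Field k] [Ring A] [HopfAlgebra k A] [IsLocalRing A]

/-- A nonzero `v` in a simple submodule is killed by `ker ε`: otherwise `v = b a v` with `ε(a) = 0`,
but `b a` is not a unit, so `1 - b a` is one and `v = 0`. -/
theorem exists_ne_zero_forall_smul_eq_counit_smul (V : Type*) [AddCommGroup V] [Module k V]
    [Module A V] [IsScalarTower k A V] [Module.Finite k V] [Nontrivial V] :
    ∃ v : V, v ≠ 0 ∧ ∀ a : A, a • v = Coalgebra.counit (R := k) a • v := by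
  have : IsArtinian A V := isArtinian_of_tower k inferInstance
  obtain ⟨W, hW⟩ := IsAtomic.exists_atom (Submodule A V)
  obtain ⟨v, hvW, hv⟩ := W.exists_mem_ne_zero_of_ne_bot hW.1
  have key : ∀ a : A, Coalgebra.counit (R := k) a = 0 → a • v = 0 := by
    intro a ha
    by_contra hav
    have hle : A ∙ (a • v) = W := by
      refine (hW.le_iff.1 ?_).resolve_left (by simpa using hav)
      rw [Submodule.span_singleton_le_iff_mem]
      exact W.smul_mem a hvW
    rw [← hle, Submodule.mem_span_singleton] at hvW
    obtain ⟨b, hb⟩ := hvW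
    have hunit : IsUnit (1 - b * a) := by
      refine (IsLocalRing.isUnit_or_isUnit_of_add_one (add_sub_cancel (b * a) 1)).resolve_left ?_
      intro hu
      have := hu.map (Bialgebra.counitAlgHom k A)
      simp [ha] at this
    refine hv (hunit.smul_eq_zero.1 ?_)
    rw [sub_smul, one_smul, mul_smul, hb, sub_self]
  refine ⟨v, hv, fun a => ?_⟩
  have := key (a - algebraMap k A (Coalgebra.counit a)) (by simp)
  rwa [sub_smul, sub_eq_zero, algebraMap_smul] at this

theorem eq_bot_of_forall_invariant {V : Type*} [AddCommGroup V] [Module k V]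
    [Module A V] [IsScalarTower k A V] [Module.Finite k V] (W : Submodule A V)
    (h : ∀ v ∈ W, (∀ a : A, a • v = Coalgebra.counit (R := k) a • v) → v = 0) : W = ⊥ := by
  by_contra hW
  have : Nontrivial W := Submodule.nontrivial_iff_ne_bot.2 hW
  have : Module.Finite k W :=
    Module.Finite.of_injective (W.subtype.restrictScalars k) W.subtype_injective
  obtain ⟨v, hv, hinv⟩ := exists_ne_zero_forall_smul_eq_counit_smul (k := k) (A := A) W
  exact hv (Subtype.ext (h v v.2 fun a => congrArg Subtype.val (hinv a)))

end LocalRing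

/-! ### Bijectivity of `j` for local `A` -/

section Galois

variable {k A S : Type*} [Field k] [Ring A] [HopfAlgebra k A] [CommRing S] [Algebra k S]
  [Module A S] [IsScalarTower k A S]

/-- For a family `e` in `S`, the map `S^ι → Hom(A, S)` sending `t` to `a ↦ ∑ e_i (a t_i)`. -/
def sumMulOrbit {ι : Type*} [Fintype ι] (e : ι → S) : (ι → S) →ₗ[k] A →ₗ[k] S :=
  ∑ i, (LinearMap.compRight k (LinearMap.mulLeft k (e i))) ∘ₗ
    (action k A S).toLinearMap.flip ∘ₗ LinearMap.proj i

theorem sumMulOrbit_apply {ι : Type*} [Fintype ι] (e : ι → S) (t : ι → S) (a : A) :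
    sumMulOrbit (k := k) e t a = ∑ i, e i * a • t i := by
  simp [sumMulOrbit, LinearMap.sum_apply]

/-- The kernel is an `A`-submodule of `S^ι`. An invariant tuple in it has entries in `k`, and the
relation at `a = 1` is then a linear relation among the `e_i`. -/
theorem sumMulOrbit_injective [IsLocalRing A] [Module.Finite k S]
    (hext : IsHopfExtension k A S) {ι : Type*} [Fintype ι]
    {e : ι → S} (he : LinearIndependent k e) :
    Function.Injective (sumMulOrbit (k := k) (A := A) e) := by
  let K : Submodule A (ι → S) :=
    { carrier := {t | ∀ a : A, ∑ i, e i * a • t i = 0}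
      add_mem' := fun {t u} ht hu a => by
        simp only [Pi.add_apply, smul_add, mul_add, Finset.sum_add_distrib, ht a, hu a, add_zero]
      zero_mem' := fun a => by simp
      smul_mem' := fun b t ht a => by simpa only [Pi.smul_apply, smul_smul] using ht (a * b) }
  have hK : K = ⊥ := by
    refine eq_bot_of_forall_invariant (k := k) K fun t ht hinv => ?_
    have hc : ∀ i, ∃ c : k, algebraMap k S c = t i := fun i => by
      have : t i ∈ invariants (action k A S) := fun a => congrFun (hinv a) i
      rw [hext.2] at this
      simpa using this
    choose c hc using hc
    have h0 : ∑ i, c i • e i = 0 := by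
      rw [← ht 1]
      refine Finset.sum_congr rfl fun i _ => ?_
      rw [one_smul, ← hc, Algebra.smul_def, mul_comm]
    ext i
    rw [← hc i, Fintype.linearIndependent_iff.1 he c h0 i, map_zero, Pi.zero_apply]
  rw [← LinearMap.ker_eq_bot, LinearMap.ker_eq_bot']
  intro t ht
  have : t ∈ K := fun a => by rw [← sumMulOrbit_apply (k := k), ht, LinearMap.zero_apply]
  rwa [hK, Submodule.mem_bot] at this

/-- Over a field, if `A` is local and `S^A = k` then `S` is Hopf-Galois as soon as the ranks
agree. -/
theorem isHopfGalois_of_isLocalRing [IsLocalRing A] [Module.Finite k A] [Module.Finite k S]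
    (hrank : Module.finrank k S = Module.finrank k A)
    (hext : IsHopfExtension k A S) : IsHopfGalois k A S := by
  let e := Module.finBasis k S
  let b := Module.finBasis k A
  have hsurj : Function.Surjective (sumMulOrbit (k := k) (A := A) e) := by
    refine (LinearMap.injective_iff_surjective_of_finrank_eq_finrank ?_).1
      (sumMulOrbit_injective hext e.linearIndependent)
    rw [Module.finrank_pi_fintype, Module.finrank_linearMap]
    simp [hrank]
  -- Under the pairing `(h, s ⊗ a) ↦ s h(a)`, the map `sumMulOrbit e` is adjoint to `j`; its
  -- surjectivity makes `ker j` pair to zero with all of `Hom(A, S)`.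
  let P : (A →ₗ[k] S) → S ⊗[k] A →ₗ[k] S := fun h => LinearMap.mul' k S ∘ₗ h.lTensor S
  have hP : ∀ (t : Fin _ → S) (x : S ⊗[k] A), P (sumMulOrbit e t) x =
      ∑ i, e i * galoisMap k A S x (t i) := by
    intro t x
    induction x with
    | zero => simp
    | add x y hx hy => simp only [map_add, hx, hy, LinearMap.add_apply, mul_add,
        Finset.sum_add_distrib]
    | tmul s a =>
      simp only [P, LinearMap.comp_apply, LinearMap.lTensor_tmul, LinearMap.mul'_apply,
        sumMulOrbit_apply, galoisMap_tmul, Finset.mul_sum]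
      exact Finset.sum_congr rfl fun i _ => mul_left_comm _ _ _
  have hinj : Function.Injective (galoisMap k A S) := by
    rw [← LinearMap.ker_eq_bot, LinearMap.ker_eq_bot']
    intro x hx
    have hx0 : ∀ h, P h x = 0 := fun h => by
      obtain ⟨t, rfl⟩ := hsurj h
      simp [hP, hx]
    apply (TensorProduct.equivFinsuppOfBasisRight b).injective
    ext j
    -- Pairing with the coordinate functionals of `A` reads off the `S`-coordinates, so the pairing
    -- detects zero.
    have : ∀ y, TensorProduct.equivFinsuppOfBasisRight b y j =
        P ((Algebra.linearMap k S) ∘ₗ b.coord j) y := by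
      intro y
      induction y with
      | zero => simp
      | add x y hx hy => simp only [map_add, Finsupp.add_apply, hx, hy]
      | tmul s a =>
        simp [P, Algebra.smul_def, mul_comm]
    rw [this, hx0, map_zero, Finsupp.zero_apply]
  refine ⟨hinj, (LinearMap.injective_iff_surjective_of_finrank_eq_finrank ?_).1 hinj⟩
  rw [Module.finrank_tensorProduct, Module.finrank_linearMap, hrank]

/-! ### Zero homology of Hopf-Galois extensions -/

/-- For a family `e` in `S`, the map `A^ι → End(S)` sending `a` to `t ↦ ∑ a_i (e_i t)`. -/
def sumSmulMul {ι : Type*} [Fintype ι] (e : ι → S) : (ι → A) →ₗ[k] Module.End k S :=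
  ∑ i, (LinearMap.lcomp k S (LinearMap.mulLeft k (e i))) ∘ₗ
    (action k A S).toLinearMap ∘ₗ LinearMap.proj i

theorem sumSmulMul_apply {ι : Type*} [Fintype ι] (e : ι → S) (a : ι → A) (t : S) :
    sumSmulMul (k := k) e a t = ∑ i, a i • (e i * t) := by
  simp [sumSmulMul, LinearMap.sum_apply]

/-- As `S` is commutative, `s (a t) = (a t) s = ∑ a₁ (t (S(a₂) s))`: operators with `S` on the left
of `A` can be rewritten with `S` on the right. -/
theorem sumSmulMul_surjective (hmod : IsModuleAlgebra k A S) {ι : Type*} [Fintype ι]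
    (e : Module.Basis ι k S) (hj : Function.Surjective (galoisMap k A S)) :
    Function.Surjective (sumSmulMul (k := k) (A := A) e) := by
  rw [← LinearMap.range_eq_top, eq_top_iff, ← LinearMap.range_eq_top.2 hj]
  have h1 : ∀ (a : A) (s : S), action k A S a * LinearMap.mulLeft k s ∈
      LinearMap.range (sumSmulMul (k := k) (A := A) e) := by
    intro a s
    refine ⟨fun i => e.repr s i • a, ?_⟩
    ext t
    conv_rhs => rw [← e.sum_repr s]
    simp only [sumSmulMul_apply, Module.End.mul_apply, LinearMap.mulLeft_apply, Finset.sum_mul,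
      map_sum, smul_mul_assoc, map_smul, smul_assoc]
    rfl
  rintro _ ⟨x, rfl⟩
  induction x with
  | zero => simp
  | add x y hx hy => rw [map_add]; exact add_mem hx hy
  | tmul s a =>
    let F : A ⊗[k] A →ₗ[k] Module.End k S := TensorProduct.lift
      ((LinearMap.mul k (Module.End k S)).compl₁₂ (action k A S).toLinearMap
        (LinearMap.mul k S ∘ₗ orbit k A s ∘ₗ HopfAlgebra.antipode k))
    have h2 : ∀ x, F x ∈ LinearMap.range (sumSmulMul (k := k) (A := A) e) := by
      intro x
      induction x with
      | zero => simp
      | add x y hx hy => rw [map_add]; exact add_mem hx hy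
      | tmul b c => exact h1 b _
    convert h2 (Coalgebra.comul a) using 1
    ext t
    rw [galoisMap_tmul, mul_comm, hmod.smul_mul_eq]
    induction Coalgebra.comul (R := k) a with
    | zero => simp
    | add x y hx hy => simp only [map_add, LinearMap.add_apply, hx, hy]
    | tmul b c => simp [F, orbit, mul_comm]

theorem IsHopfGalois.one_mem_integralImage [Module.Finite k A] [Module.Finite k S]
    (hmod : IsModuleAlgebra k A S) (hrank : Module.finrank k S = Module.finrank k A)
    (hext : IsHopfExtension k A S) (hj : IsHopfGalois k A S) :
    (1 : S) ∈ integralImage (action k A S) := by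
  let e := Module.finBasis k S
  have hsurj := sumSmulMul_surjective hmod e hj.2
  have hinj : Function.Injective (sumSmulMul (k := k) (A := A) e) := by
    refine (LinearMap.injective_iff_surjective_of_finrank_eq_finrank ?_).2 hsurj
    rw [Module.finrank_pi_fintype, Module.finrank_linearMap]
    simp [hrank]
  -- `φ` is a `k`-linear retraction `S → k`, and `l` lists the `A`-coordinates of the resulting
  -- projection of `S` onto `k`.
  obtain ⟨φ, hφ⟩ := (Algebra.linearMap k S).exists_leftInverse_of_injective
    (LinearMap.ker_eq_bot.2 hext.1)
  obtain ⟨l, hl⟩ := hsurj (Algebra.linearMap k S ∘ₗ φ)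
  have hint : ∀ i, l i ∈ leftIntegrals k A := by
    intro i a
    -- The projection has values in `k`, where `a` acts as `ε(a)`; uniqueness of coordinates passes
    -- this on to each `l i`.
    refine congrFun (hinj (a₁ := fun i => a * l i)
      (a₂ := fun i => Coalgebra.counit (R := k) a • l i) ?_) i
    ext t
    have h1 := congrArg (a • ·) (LinearMap.congr_fun hl t)
    have h2 := congrArg (Coalgebra.counit (R := k) a • ·) (LinearMap.congr_fun hl t)
    have h3 : a • algebraMap k S (φ t) = Coalgebra.counit (R := k) a • algebraMap k S (φ t) := by
      rw [Algebra.algebraMap_eq_smul_one, smul_comm, hmod.smul_one, Algebra.algebraMap_eq_smul_one,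
        smul_comm]
    simp only [sumSmulMul_apply, Finset.smul_sum, LinearMap.comp_apply,
      Algebra.linearMap_apply] at h1 h2
    simp only [sumSmulMul_apply, mul_smul, smul_assoc]
    rw [h1, h2, h3]
  have h1 := LinearMap.congr_fun hl 1
  have hφ1 : φ 1 = 1 := by simpa using LinearMap.congr_fun hφ 1
  rw [sumSmulMul_apply, LinearMap.comp_apply, hφ1, Algebra.linearMap_apply, map_one] at h1
  rw [← h1]
  exact sum_mem fun i _ => Submodule.subset_span ⟨l i, hint i, _, rfl⟩

theorem IsHopfGalois.subsingleton_hopfologicalHomology [Module.Finite k A] [Module.Finite k S]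
    (hmod : IsModuleAlgebra k A S) (hrank : Module.finrank k S = Module.finrank k A)
    (hext : IsHopfExtension k A S) (hj : IsHopfGalois k A S) :
    Subsingleton (HopfologicalHomology (action k A S)) := by
  rw [subsingleton_hopfologicalHomology_iff, hext.2]
  rintro _ ⟨c, rfl⟩
  rw [Algebra.linearMap_apply, Algebra.algebraMap_eq_smul_one]
  exact Submodule.smul_mem _ c (hj.one_mem_integralImage hmod hrank hext)

end Galois

end HopfTame

end

theorem theorem1 {R A S : Type*} [CommRing R] [IsLocalRing R]
    [Ring A] [HopfAlgebra R A] [Module.Finite R A] [Module.Projective R A]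
    [CommRing S] [Algebra R S] [Module.Finite R S] [Module.Projective R S]
    [Module A S] [IsScalarTower R A S]
    (hmod : HopfTame.IsModuleAlgebra R A S)
    (hfaithful : ∀ a : A, (∀ s : S, a • s = 0) → a = 0)
    (hrank : Module.finrank R S = Module.finrank R A)
    (hext : HopfTame.IsHopfExtension R A S) :
    (IsDomain R → IsPrincipalIdealRing R →
      (HopfTame.IsTame R A S ↔
        Subsingleton (HopfTame.HopfologicalHomology (HopfTame.action R A S)))) ∧
    (IsField R → HopfTame.IsTame R A S →
      ∀ (M : Type*) [AddCommGroup M] [Module R M] [Module S M] [IsScalarTower R S M]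
        (C : HopfTame.DualComodule R A M),
        C.IsRightHopfModule S ∨ C.IsLeftHopfModule S →
          Subsingleton (HopfTame.HopfologicalHomology C.toAction)) ∧
    (IsField R → IsLocalRing A → Coalgebra.IsCocomm R A →
      (HopfTame.IsHopfGalois R A S ↔
        Subsingleton (HopfTame.HopfologicalHomology (HopfTame.action R A S)))) := by
  refine ⟨fun _ _ => HopfTame.isTame_iff hfaithful hrank hext,
    fun _ htame M _ _ _ _ C hC => htame.subsingleton_hopfologicalHomology hC,
    fun hR hA _ => ?_⟩
  let := hR.toField
  exact ⟨fun hj => hj.subsingleton_hopfologicalHomology hmod hrank hext,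
    fun _ => HopfTame.isHopfGalois_of_isLocalRing hrank hext⟩
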